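/- Let $\mathbb{X}_2$ denote the set of convex domains (non-empty open convex subsets) of $\mathbb{C}^2$ that contain no complex affine line, let $\mathbb{D}\subset\mathbb{C}$ be the open unit disc, and let $\mathbb{B}(0;R)\subset\mathbb{C}^2$ be the open Euclidean ball of radius $R$ about the origin. Say that domains $\Omega_n\in\mathbb{X}_2$ converge to $\Omega'\in\mathbb{X}_2$ if there is $R_0\ge 0$ such that for every $R\ge R_0$ the Hausdorff distance between $\Omega_n\cap\mathbb{B}(0;R)$ and $\Omega'\cap\mathbb{B}(0;R)$ tends to $0$ (the distance between an empty and a non-empty set being $+\infty$). A domain $\Omega_\infty\in\mathbb{X}_2$ is an affine limit of $\Omega\in\mathbb{X}_2$ if there are points $z_n\in\Omega$ that eventually leave every compact subset of $\Omega$, complex affine automorphisms $A_n$ of $\mathbb{C}^2$, and a point $z_\infty\in\Omega_\infty$ such that $A_n\Omega$ converges to $\Omega_\infty$ and $A_nz_n\to z_\infty$. Theorem. Let $\Omega\in\mathbb{X}_2$, and suppose that $\partial\Omega$ contains a non-trivial affine disc, that is, a set $\ell(\mathbb{D})$ with $\ell:\mathbb{C}\to\mathbb{C}^2$ a non-constant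 complex affine map. Then there exist non-empty open convex sets $D_1,D_2\subset\mathbb{C}$ such that $D_1\times D_2$ is an affine limit of $\Omega$ and $D_1\times D_2$ is biholomorphic to $\mathbb{D}\times\mathbb{D}$. -/

import Mathlib

open Filter Topology

/-- `Ω` is a convex domain in `ℂ^d` (Euclidean norm) containing no complex affine line. -/
structure IsConvexDomainNoLine {d : ℕ} (Ω : Set (EuclideanSpace ℂ (Fin d))) : Prop where
  isOpen : IsOpen Ω
  nonempty : Ω.Nonempty
  convex : Convex ℝ Ω
  not_line : ∀ p v : EuclideanSpace ℂ (Fin d), v ≠ 0 → ∃ t : ℂ, p + t • v ∉ Ω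

/-- `A` is the image of the open unit disc under a non-constant complex affine map `ℂ → ℂ^d`. -/
def IsNontrivialAffineDisk {d : ℕ} (A : Set (EuclideanSpace ℂ (Fin d))) : Prop :=
  ∃ l : ℂ →ᵃ[ℂ] EuclideanSpace ℂ (Fin d), (∃ s t : ℂ, l s ≠ l t) ∧ l '' Metric.ball 0 1 = A

/-- The local Hausdorff semi-norm: the Hausdorff distance between the parts of `A` and `B` inside
the open ball of radius `R` around `0` (it is `⊤` if exactly one of these parts is empty). -/
noncomputable def localHausdorff {d : ℕ} (R : ℝ) (A B : Set (EuclideanSpace ℂ (Fin d))) :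
    ENNReal :=
  Metric.hausdorffEDist (A ∩ Metric.ball 0 R) (B ∩ Metric.ball 0 R)

/-- Convergence of a sequence of domains in the local Hausdorff sense. -/
def LocalHausdorffTendsto {d : ℕ} (Ωs : ℕ → Set (EuclideanSpace ℂ (Fin d)))
    (Ω : Set (EuclideanSpace ℂ (Fin d))) : Prop :=
  ∃ R₀ : ℝ, 0 ≤ R₀ ∧ ∀ R : ℝ, R₀ ≤ R →
    Tendsto (fun n => localHausdorff R (Ωs n) Ω) atTop (𝓝 0)

/-- The sequence `z` in `Ω` eventually leaves every compact subset of `Ω`. -/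
def CompactlyDivergent {d : ℕ} (Ω : Set (EuclideanSpace ℂ (Fin d)))
    (z : ℕ → EuclideanSpace ℂ (Fin d)) : Prop :=
  ∀ K : Set (EuclideanSpace ℂ (Fin d)), K ⊆ Ω → IsCompact K → ∃ N : ℕ, ∀ n, N ≤ n → z n ∉ K

/-- `Ω'` is an affine limit of `Ω`: it is a convex domain without complex affine lines, and the
pointed domains `A n (Ω, z n)` converge to `(Ω', z')` for affine automorphisms `A n` of `ℂ^d`
and a compactly divergent sequence `z n` in `Ω`. -/
def IsAffineLimit {d : ℕ} (Ω Ω' : Set (EuclideanSpace ℂ (Fin d))) : Prop :=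
  IsConvexDomainNoLine Ω' ∧
    ∃ (z : ℕ → EuclideanSpace ℂ (Fin d)) (z' : EuclideanSpace ℂ (Fin d))
      (A : ℕ → (EuclideanSpace ℂ (Fin d) ≃ᵃ[ℂ] EuclideanSpace ℂ (Fin d))),
      (∀ n, z n ∈ Ω) ∧ z' ∈ Ω' ∧ CompactlyDivergent Ω z ∧
        LocalHausdorffTendsto (fun n => A n '' Ω) Ω' ∧
        Tendsto (fun n => A n (z n)) atTop (𝓝 z')

/-- The product `U × V` as a subset of `ℂ^2`. -/
def prodDomain (U V : Set ℂ) : Set (EuclideanSpace ℂ (Fin 2)) :=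
  {z | z 0 ∈ U ∧ z 1 ∈ V}

/-- The open sets `U` and `V` are biholomorphic. -/
def Biholomorphic {d : ℕ} (U V : Set (EuclideanSpace ℂ (Fin d))) : Prop :=
  ∃ f g : EuclideanSpace ℂ (Fin d) → EuclideanSpace ℂ (Fin d),
    DifferentiableOn ℂ f U ∧ DifferentiableOn ℂ g V ∧
      Set.MapsTo f U V ∧ Set.MapsTo g V U ∧ Set.InvOn g f U V

/-!
The affine limit produced here is the product of two half-planes `{Re u > 0}`, which the Cayley
transform maps onto the bidisc (`biholomorphic_rightHalfPlane_prod`).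

A real hyperplane supporting `Ω` at the centre of the disc contains the disc, so there are affine
coordinates `(z₀, z₁)` in which `Ω` lies in `{Re z₁ > 0}` and the disc in the line `{z₁ = 0}`
(`exists_affineEquiv_ball_subset_baseFace`). The closure of `Ω` meets this line in a closed convex
set `F` with interior (`baseFace`), which is not the whole line because `Ω` contains no complex
line (`baseFace_ne_univ`). Let `S` be the open convex cone spanned by the projection of `Ω` to the
`z₁`-axis (`fibreCone`). The dilations `(z₀, z₁) ↦ (z₀, z₁ / τ)` with `τ → 0` turn `Ω` into a
domain that, on bounded sets, is close to `interior F × S`: compact subsets of the product are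
eventually covered (`eventually_mem_of_mem_interior_baseFace`), the second coordinate always stays
in `S`, and the first coordinate is eventually close to `F`
(`eventually_lt_of_forall_mem_baseFace`).

Neither `F` nor `S` need be a half-plane, or even have a smooth boundary. But a planar convex
domain other than `ℂ` has a boundary point `q` at which an inscribed disc touches, namely a
boundary point nearest to some interior point; magnifying the domain at `q` gives a half-plane
(`exists_ball_subset_subset_halfPlane`). Combining a magnification of both coordinates by `n + 1`
at such points with a dilation of strength `τ n` chosen sufficiently small afterwards gives a
sequence of affine maps under which `Ω` converges to the product of half-planes
(`isAffineLimit_rightHalfPlane_prod_of_ball_subset_baseFace`). The base points are the preimages of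
`(1, 1)`; they tend to a point of the line `{z₁ = 0}`, which misses `Ω`.
-/

/-! ### The product of two half-planes -/

/-- The open right half-plane. -/
def rightHalfPlane : Set ℂ := {u | 0 < u.re}

lemma isOpen_rightHalfPlane : IsOpen rightHalfPlane :=
  isOpen_lt continuous_const Complex.continuous_re

lemma convex_rightHalfPlane : Convex ℝ rightHalfPlane :=
  convex_halfSpace_re_gt 0

lemma nonempty_rightHalfPlane : rightHalfPlane.Nonempty :=
  ⟨1, by simp [rightHalfPlane]⟩

lemma EuclideanSpace.eq_vec_two (z : EuclideanSpace ℂ (Fin 2)) : z = !₂[z 0, z 1] := by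
  ext i; fin_cases i <;> simp

lemma EuclideanSpace.continuous_vec_two :
    Continuous fun p : ℂ × ℂ => (!₂[p.1, p.2] : EuclideanSpace ℂ (Fin 2)) := by
  fun_prop

lemma isConvexDomainNoLine_rightHalfPlane_prod :
    IsConvexDomainNoLine (prodDomain rightHalfPlane rightHalfPlane) where
  isOpen := (isOpen_rightHalfPlane.preimage (by fun_prop)).inter
    (isOpen_rightHalfPlane.preimage (by fun_prop))
  nonempty := ⟨!₂[1, 1], by simp [prodDomain, rightHalfPlane]⟩
  convex := by
    intro x hx y hy a b ha hb hab
    exact ⟨by simpa using convex_rightHalfPlane hx.1 hy.1 ha hb hab,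
      by simpa using convex_rightHalfPlane hx.2 hy.2 ha hb hab⟩
  not_line := by
    intro p v hv
    obtain ⟨i, hi⟩ : ∃ i, v i ≠ 0 := by
      by_contra! h
      exact hv (by ext i; simpa using h i)
    -- the value of `t` for which the `i`-th coordinate of `p + t • v` vanishes
    refine ⟨-p i / v i, fun h => ?_⟩
    have h0 : (p + (-p i / v i) • v) i = 0 := by
      simp [div_mul_cancel₀ _ hi]
    have : (0 : ℝ) < ((p + (-p i / v i) • v) i).re := by
      fin_cases i
      · exact h.1
      · exact h.2
    rw [h0] at this
    simp at this

/-- The Cayley transform, applied to each coordinate. -/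
lemma biholomorphic_rightHalfPlane_prod :
    Biholomorphic (prodDomain rightHalfPlane rightHalfPlane)
      (prodDomain (Metric.ball (0 : ℂ) 1) (Metric.ball (0 : ℂ) 1)) := by
  have key : ∀ u : ℂ, 0 < u.re → u + 1 ≠ 0 := fun u hu h => by
    have := congrArg Complex.re h
    simp at this
    linarith
  have key' : ∀ u : ℂ, u ∈ Metric.ball (0 : ℂ) 1 → 1 - u ≠ 0 := fun u hu h => by
    rw [← sub_eq_zero.1 h] at hu
    simp at hu
  have maps : ∀ u : ℂ, 0 < u.re → (u - 1) / (u + 1) ∈ Metric.ball (0 : ℂ) 1 := fun u hu => by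
    have h1 : 0 < ‖u + 1‖ := norm_pos_iff.2 (key u hu)
    rw [mem_ball_zero_iff, norm_div, div_lt_one h1]
    refine lt_of_pow_lt_pow_left₀ 2 h1.le ?_
    rw [Complex.sq_norm, Complex.sq_norm, Complex.normSq_apply, Complex.normSq_apply]
    simp
    nlinarith
  have maps' : ∀ u : ℂ, u ∈ Metric.ball (0 : ℂ) 1 → 0 < ((1 + u) / (1 - u)).re := fun u hu => by
    have h1 : 0 < Complex.normSq (1 - u) := Complex.normSq_pos.2 (key' u hu)
    have h2 : ‖u‖ ^ 2 < 1 := by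
      have := mem_ball_zero_iff.1 hu
      nlinarith [norm_nonneg u]
    rw [Complex.sq_norm, Complex.normSq_apply] at h2
    rw [Complex.div_re, ← add_div]
    refine div_pos ?_ h1
    simp
    nlinarith
  refine ⟨fun z => !₂[(z 0 - 1) / (z 0 + 1), (z 1 - 1) / (z 1 + 1)],
    fun z => !₂[(1 + z 0) / (1 - z 0), (1 + z 1) / (1 - z 1)], ?_, ?_, ?_, ?_, ?_, ?_⟩
  · rw [differentiableOn_euclidean]
    have d (i : Fin 2) (hi : ∀ z ∈ prodDomain rightHalfPlane rightHalfPlane, 0 < (z i).re) :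
        DifferentiableOn ℂ (fun z : EuclideanSpace ℂ (Fin 2) => (z i - 1) / (z i + 1))
          (prodDomain rightHalfPlane rightHalfPlane) := by
      simp only [div_eq_mul_inv]
      exact DifferentiableOn.mul (by fun_prop)
        (DifferentiableOn.inv (by fun_prop) fun z hz => key _ (hi z hz))
    intro i
    fin_cases i
    · exact d 0 fun z hz => hz.1
    · exact d 1 fun z hz => hz.2
  · rw [differentiableOn_euclidean]
    have d (i : Fin 2) (hi : ∀ z ∈ prodDomain (Metric.ball (0 : ℂ) 1) (Metric.ball (0 : ℂ) 1),
        z i ∈ Metric.ball (0 : ℂ) 1) :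
        DifferentiableOn ℂ (fun z : EuclideanSpace ℂ (Fin 2) => (1 + z i) / (1 - z i))
          (prodDomain (Metric.ball (0 : ℂ) 1) (Metric.ball (0 : ℂ) 1)) := by
      simp only [div_eq_mul_inv]
      exact DifferentiableOn.mul (by fun_prop)
        (DifferentiableOn.inv (by fun_prop) fun z hz => key' _ (hi z hz))
    intro i
    fin_cases i
    · exact d 0 fun z hz => hz.1
    · exact d 1 fun z hz => hz.2
  · exact fun z hz => ⟨maps _ hz.1, maps _ hz.2⟩
  · exact fun z hz => ⟨maps' _ hz.1, maps' _ hz.2⟩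
  · have inv : ∀ u : ℂ, 0 < u.re →
        (1 + (u - 1) / (u + 1)) / (1 - (u - 1) / (u + 1)) = u := fun u hu => by
      have := key u hu
      field_simp
      ring
    intro z hz
    rw [EuclideanSpace.eq_vec_two z]
    simp [inv _ hz.1, inv _ hz.2]
  · have inv : ∀ u : ℂ, u ∈ Metric.ball (0 : ℂ) 1 →
        ((1 + u) / (1 - u) - 1) / ((1 + u) / (1 - u) + 1) = u := fun u hu => by
      have := key' u hu
      field_simp
      ring
    intro z hz
    rw [EuclideanSpace.eq_vec_two z]
    simp [inv _ hz.1, inv _ hz.2]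

/-! ### Tangent half-planes of planar convex domains -/

/-- A ball in a planar convex domain that touches the boundary at `q` forces the domain to lie in
the half-plane bounded by the tangent of the ball at `q`. In the affine coordinate `u` in which
`q` is the origin and `1` the centre of the ball, the domain lies between the disc `|u - 1| < 1`
and the half-plane `Re u > 0`. -/
lemma exists_ball_subset_subset_halfPlane {U : Set ℂ} (hU : IsOpen U) (hc : Convex ℝ U)
    (hne : U.Nonempty) (hU' : U ≠ Set.univ) :
    ∃ q ρ : ℂ, ρ ≠ 0 ∧ (∀ u, ‖u - 1‖ < 1 → q + ρ * u ∈ U) ∧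
      ∀ u, q + ρ * u ∈ U → 0 < u.re := by
  obtain ⟨a, ha⟩ := hne
  have hne' : Uᶜ.Nonempty := Set.nonempty_compl.2 hU'
  obtain ⟨q, hq, hd⟩ := hU.isClosed_compl.exists_infDist_eq_dist hne' a
  have hρ : a - q ≠ 0 := fun h => hq (by rwa [← sub_eq_zero.1 h])
  have hball : ∀ u, ‖u - 1‖ < 1 → q + (a - q) * u ∈ U := by
    intro u hu
    by_contra hn
    have h1 := Metric.infDist_le_dist_of_mem (x := a) (show q + (a - q) * u ∈ Uᶜ from hn)
    rw [hd, dist_eq_norm, dist_eq_norm,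
      show a - (q + (a - q) * u) = -((a - q) * (u - 1)) by ring, norm_neg, norm_mul] at h1
    nlinarith [norm_pos_iff.2 hρ]
  refine ⟨q, a - q, hρ, hball, fun u hu => ?_⟩
  by_contra! hre
  -- move `u` slightly to the left, so that its real part becomes negative
  obtain ⟨v, hv, hvre⟩ : ∃ v, q + (a - q) * v ∈ U ∧ v.re < 0 := by
    have hcont : Continuous fun δ : ℝ => q + (a - q) * (u - (δ : ℂ)) := by fun_prop
    have h0 : ∀ᶠ δ : ℝ in 𝓝 0, q + (a - q) * (u - (δ : ℂ)) ∈ U :=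
      hcont.continuousAt.eventually_mem (by simpa using hU.mem_nhds hu)
    obtain ⟨ε, hε, h⟩ := Metric.eventually_nhds_iff.1 h0
    refine ⟨u - ((ε / 2 : ℝ) : ℂ), h ?_, ?_⟩
    · rw [Real.dist_eq, sub_zero, abs_of_pos (by positivity)]
      linarith
    · rw [Complex.sub_re, Complex.ofReal_re]
      linarith
  -- then `0` lies strictly between `v` and the point `-s * v` of the disc
  have hn : 0 < Complex.normSq v := by
    refine Complex.normSq_pos.2 fun h => ?_
    simp [h] at hvre
  set s : ℝ := -v.re / Complex.normSq v with hs
  have hs0 : 0 < s := div_pos (by linarith) hn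
  have hsn : s * Complex.normSq v = -v.re := div_mul_cancel₀ _ hn.ne'
  have hv' : q + (a - q) * (-(s : ℂ) * v) ∈ U := by
    refine hball _ (lt_of_pow_lt_pow_left₀ 2 zero_le_one ?_)
    rw [Complex.normSq_apply] at hsn
    rw [Complex.sq_norm, Complex.normSq_apply]
    simp
    nlinarith
  refine hq ?_
  have := hc hv hv' (a := s / (1 + s)) (b := 1 / (1 + s)) (by positivity) (by positivity)
    (by field_simp; ring)
  have hs1 : (1 + s : ℂ) ≠ 0 := by exact_mod_cast (by positivity : (1 + s : ℝ) ≠ 0)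
  convert this using 1
  simp only [Complex.real_smul]
  push_cast
  field_simp
  ring

/-! ### Local Hausdorff convergence to a product of half-planes -/

/-- A criterion for local Hausdorff convergence to a product of half-planes: every point of the
product is eventually covered, and in bounded regions the domains eventually protrude from the
product by arbitrarily little. -/
lemma localHausdorffTendsto_rightHalfPlane_prod {Ωs : ℕ → Set (EuclideanSpace ℂ (Fin 2))}
    (h₁ : ∀ p ∈ prodDomain rightHalfPlane rightHalfPlane, ∀ᶠ n in atTop, p ∈ Ωs n)
    (h₂ : ∀ R δ : ℝ, 0 < δ → ∀ᶠ n in atTop, ∀ z ∈ Ωs n, ‖z‖ < R →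
      -δ < (z 0).re ∧ -δ < (z 1).re) :
    LocalHausdorffTendsto Ωs (prodDomain rightHalfPlane rightHalfPlane) := by
  refine ⟨1, zero_le_one, fun R hR => ENNReal.tendsto_nhds_zero.2 fun ε' hε' => ?_⟩
  obtain ⟨ε, hε, hεε⟩ : ∃ ε : ℝ, 0 < ε ∧ ENNReal.ofReal ε ≤ ε' := by
    rcases eq_or_ne ε' ⊤ with rfl | h
    · exact ⟨1, one_pos, le_top⟩
    · exact ⟨ε'.toReal, ENNReal.toReal_pos hε'.ne' h, ENNReal.ofReal_toReal_le⟩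
  set D := prodDomain rightHalfPlane rightHalfPlane with hD
  have htb : TotallyBounded (D ∩ Metric.ball 0 R) :=
    (isCompact_closedBall 0 R).totallyBounded.subset
      (Set.inter_subset_right.trans Metric.ball_subset_closedBall)
  obtain ⟨N, hND, hNfin, hN⟩ := Metric.finite_approx_of_totallyBounded htb ε hε
  have hcover : ∀ᶠ n in atTop, ∀ p ∈ N, p ∈ Ωs n :=
    (hNfin.eventually_all).2 fun p hp => h₁ p (hND hp).1
  -- a point of the limit domain; moving towards it repairs a slight protrusion
  set e : EuclideanSpace ℂ (Fin 2) := !₂[1 / 4, 1 / 4] with he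
  have heR : ‖e‖ < R := by
    refine lt_of_lt_of_le (lt_of_pow_lt_pow_left₀ 2 zero_le_one ?_) hR
    rw [EuclideanSpace.norm_sq_eq]
    simp [he]
    norm_num
  obtain ⟨t, ht0, ht1, htε⟩ : ∃ t : ℝ, 0 < t ∧ t < 1 ∧ t * (2 * R) ≤ ε := by
    refine ⟨min (1 / 2) (ε / (2 * R)), by positivity, by
      exact (min_le_left _ _).trans_lt (by norm_num), ?_⟩
    calc _ ≤ ε / (2 * R) * (2 * R) := by gcongr; exact min_le_right _ _
      _ = ε := by field_simp
  filter_upwards [hcover, h₂ R (t / 4) (by positivity)] with n hn1 hn2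
  refine (Metric.hausdorffEDist_le_of_mem_edist ?_ ?_).trans hεε
  · rintro z ⟨hz, hzR⟩
    rw [mem_ball_zero_iff] at hzR
    obtain ⟨h0, h1⟩ := hn2 z hz hzR
    refine ⟨(1 - t) • z + t • e, ⟨⟨?_, ?_⟩, ?_⟩, ?_⟩
    · simp [rightHalfPlane, he]
      nlinarith
    · simp [rightHalfPlane, he]
      nlinarith
    · exact convex_ball 0 R (mem_ball_zero_iff.2 hzR) (mem_ball_zero_iff.2 heR)
        (by linarith) ht0.le (by ring)
    · rw [edist_dist]
      refine ENNReal.ofReal_le_ofReal ?_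
      rw [dist_eq_norm, show z - ((1 - t) • z + t • e) = t • (z - e) by module, norm_smul,
        Real.norm_of_nonneg ht0.le]
      refine le_trans ?_ htε
      gcongr
      linarith [norm_sub_le z e]
  · intro z hz
    obtain ⟨p, hp, hzp⟩ := Set.mem_iUnion₂.1 (hN hz)
    refine ⟨p, ⟨hn1 p hp, (hND hp).2⟩, ?_⟩
    rw [edist_dist]
    exact ENNReal.ofReal_le_ofReal (Metric.mem_ball.1 hzp).le

/-! ### Affine limits -/

/-- Affine automorphisms `B n` of `ℂ^d`, read as inverses of rescalings, exhibit an affine limit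
if the preimages `B n ⁻¹' Ω` converge and the image of a single point of the limit runs to a point
outside `Ω`. -/
lemma IsAffineLimit.of_preimage {d : ℕ} {Ω Ω' : Set (EuclideanSpace ℂ (Fin d))}
    (hΩ' : IsConvexDomainNoLine Ω')
    (B : ℕ → (EuclideanSpace ℂ (Fin d) ≃ᵃ[ℂ] EuclideanSpace ℂ (Fin d)))
    {z' q : EuclideanSpace ℂ (Fin d)} (hz' : z' ∈ Ω') (hq : q ∉ Ω)
    (hmem : ∀ᶠ n in atTop, B n z' ∈ Ω) (hlim : Tendsto (fun n => B n z') atTop (𝓝 q))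
    (hconv : LocalHausdorffTendsto (fun n => B n ⁻¹' Ω) Ω') : IsAffineLimit Ω Ω' := by
  obtain ⟨N, hN⟩ := eventually_atTop.1 hmem
  refine ⟨hΩ', fun n => B (n + N) z', z', fun n => (B (n + N)).symm,
    fun n => hN _ (Nat.le_add_left _ _), hz', ?_, ?_, ?_⟩
  · intro K hK hKc
    have h : ∀ᶠ n in atTop, B (n + N) z' ∈ Kᶜ :=
      (hlim.comp (tendsto_add_atTop_nat N)).eventually_mem
        (hKc.isClosed.isOpen_compl.mem_nhds fun h => hq (hK h))
    exact eventually_atTop.1 h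
  · obtain ⟨R₀, hR₀, h⟩ := hconv
    refine ⟨R₀, hR₀, fun R hR => ?_⟩
    have him (n : ℕ) : (B (n + N)).symm '' Ω = B (n + N) ⁻¹' Ω :=
      (B (n + N)).toEquiv.symm.image_eq_preimage_symm Ω
    simp only [him]
    exact (h R hR).comp (tendsto_add_atTop_nat N)
  · simp

/-- The affine limits of `Ω` depend only on `Ω` up to complex affine automorphisms. -/
lemma IsAffineLimit.of_preimage_affineEquiv {d : ℕ} {Ω Ω' : Set (EuclideanSpace ℂ (Fin d))}
    (T : EuclideanSpace ℂ (Fin d) ≃ᵃ[ℂ] EuclideanSpace ℂ (Fin d))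
    (h : IsAffineLimit (T ⁻¹' Ω) Ω') : IsAffineLimit Ω Ω' := by
  obtain ⟨hΩ', z, z', A, hz, hz', hdiv, hconv, hlim⟩ := h
  refine ⟨hΩ', fun n => T (z n), z', fun n => T.symm.trans (A n), hz, hz', ?_, ?_, ?_⟩
  · intro K hK hKc
    have hT : Continuous T.symm := T.symm.toAffineMap.continuous_of_finiteDimensional
    obtain ⟨N, hN⟩ := hdiv (T.symm '' K) (by
      rintro _ ⟨x, hx, rfl⟩
      simpa using hK hx) (hKc.image hT)
    exact ⟨N, fun n hn hmem => hN n hn ⟨_, hmem, by simp⟩⟩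
  · convert hconv using 2 with n
    have : T ⁻¹' Ω = T.symm '' Ω := (T.toEquiv.symm.image_eq_preimage_symm Ω).symm
    rw [this, Set.image_image]
    rfl
  · simpa using hlim

/-- The affine automorphism of `ℂ^d` acting on the `i`-th coordinate by `u ↦ b i + c i * u`. -/
noncomputable def diagAffineEquiv {d : ℕ} (b c : Fin d → ℂ) (hc : ∀ i, c i ≠ 0) :
    EuclideanSpace ℂ (Fin d) ≃ᵃ[ℂ] EuclideanSpace ℂ (Fin d) where
  toFun z := WithLp.toLp 2 fun i => b i + c i * z i
  invFun z := WithLp.toLp 2 fun i => (z i - b i) / c i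
  left_inv z := by ext i; simp [hc i]
  right_inv z := by ext i; simp [mul_div_cancel₀ _ (hc i)]
  linear :=
    { toFun := fun z => WithLp.toLp 2 fun i => c i * z i
      invFun := fun z => WithLp.toLp 2 fun i => z i / c i
      left_inv := fun z => by ext i; simp [hc i]
      right_inv := fun z => by ext i; simp [mul_div_cancel₀ _ (hc i)]
      map_add' := fun x y => by ext i; simp [mul_add]
      map_smul' := fun a x => by ext i; simp; ring }
  map_vadd' p v := by ext i; simp; ring

lemma diagAffineEquiv_apply {d : ℕ} (b c : Fin d → ℂ) (hc : ∀ i, c i ≠ 0)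
    (z : EuclideanSpace ℂ (Fin d)) (i : Fin d) :
    diagAffineEquiv b c hc z i = b i + c i * z i := rfl

/-! ### The face and the cone of fibre directions -/

/-- The intersection of the closure of `Ω` with the line `{z₁ = 0}`, as a subset of `ℂ`. It is a
face of the closure when `Ω` lies in `{Re z₁ > 0}`. -/
def baseFace (Ω : Set (EuclideanSpace ℂ (Fin 2))) : Set ℂ := {a | !₂[a, 0] ∈ closure Ω}

/-- The cone with apex `0` spanned by the projection of `Ω` to the last coordinate. -/
def fibreCone (Ω : Set (EuclideanSpace ℂ (Fin 2))) : Set ℂ :=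
  {w | ∃ s : ℝ, 0 < s ∧ ∃ p : ℂ, !₂[p, (s : ℂ) * w] ∈ Ω}

lemma convex_baseFace {Ω : Set (EuclideanSpace ℂ (Fin 2))} (hc : Convex ℝ Ω) :
    Convex ℝ (baseFace Ω) := by
  intro x hx y hy a b ha hb hab
  have := hc.closure hx hy ha hb hab
  rw [EuclideanSpace.eq_vec_two (_ + _)] at this
  simpa [baseFace] using this

lemma isOpen_fibreCone {Ω : Set (EuclideanSpace ℂ (Fin 2))} (ho : IsOpen Ω) :
    IsOpen (fibreCone Ω) := by
  have : fibreCone Ω = ⋃ s : ℝ, ⋃ _ : 0 < s, ⋃ p : ℂ,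
      (fun w => (!₂[p, (s : ℂ) * w] : EuclideanSpace ℂ (Fin 2))) ⁻¹' Ω := by
    ext w
    simp [fibreCone]
  rw [this]
  exact isOpen_iUnion fun s => isOpen_iUnion fun _ => isOpen_iUnion fun p =>
    ho.preimage (EuclideanSpace.continuous_vec_two.comp
      (continuous_const.prodMk (continuous_const.mul continuous_id)))

lemma convex_fibreCone {Ω : Set (EuclideanSpace ℂ (Fin 2))} (hc : Convex ℝ Ω) :
    Convex ℝ (fibreCone Ω) := by
  rintro x ⟨s, hs, p, hx⟩ y ⟨t, ht, q, hy⟩ a b ha hb hab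
  have hpos : 0 < a * t + b * s := by
    rcases ha.eq_or_lt with rfl | ha
    · rw [show b = 1 by linarith]
      simpa using hs
    · positivity
  -- the convex combination of the two points of `Ω` lying over a positive multiple of
  -- `a • x + b • y`
  have h := hc hx hy (a := a * t / (a * t + b * s)) (b := b * s / (a * t + b * s))
    (by positivity) (by positivity) (by rw [← add_div, div_self hpos.ne'])
  rw [EuclideanSpace.eq_vec_two (_ + _)] at h
  refine ⟨s * t / (a * t + b * s), by positivity,
    (a * t / (a * t + b * s) : ℝ) * p + (b * s / (a * t + b * s) : ℝ) * q, ?_⟩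
  convert h using 1
  have h0 : (a * t + b * s : ℂ) ≠ 0 := by exact_mod_cast hpos.ne'
  ext i
  fin_cases i
  · simp
  · simp
    field_simp

/-- If the face on the line `{z₁ = 0}` were the whole line, then `Ω` would contain a parallel
line. -/
lemma baseFace_ne_univ {Ω : Set (EuclideanSpace ℂ (Fin 2))} (hΩ : IsConvexDomainNoLine Ω) :
    baseFace Ω ≠ Set.univ := by
  intro huniv
  obtain ⟨x, hx⟩ := hΩ.nonempty
  obtain ⟨a, ha⟩ := hΩ.not_line x !₂[1, 0] (fun h => by
    have := congrArg (fun z : EuclideanSpace ℂ (Fin 2) => z 0) h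
    simp at this)
  apply ha
  -- `x + (a, 0)` is the combination of `x / (1 - t)`, which is in `Ω` for small `t`, and of the
  -- point `(a / t, 0)` of the face
  have hcont : ContinuousAt (fun t : ℝ => (1 - t)⁻¹ • x) 0 := by
    have h1 : ContinuousAt (fun t : ℝ => 1 - t) 0 := by fun_prop
    exact (h1.inv₀ (by simp)).smul continuousAt_const
  have hev : ∀ᶠ t : ℝ in 𝓝 0, (1 - t)⁻¹ • x ∈ Ω :=
    hcont.eventually_mem (by simpa using hΩ.isOpen.mem_nhds hx)
  obtain ⟨ε, hε, h⟩ := Metric.eventually_nhds_iff.1 hev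
  obtain ⟨t, ht0, ht⟩ : ∃ t : ℝ, 0 < t ∧ t < min ε 1 := exists_between (by positivity)
  have htx := h (y := t) (by
    rw [Real.dist_eq, sub_zero, abs_of_pos ht0]
    exact ht.trans_le (min_le_left _ _))
  have ht1 : t < 1 := ht.trans_le (min_le_right _ _)
  have hface : !₂[a / t, 0] ∈ closure Ω := (Set.ext_iff.1 huniv (a / t)).2 trivial
  rw [← hΩ.isOpen.interior_eq] at htx
  have hmem := hΩ.convex.combo_interior_closure_mem_interior htx hface
    (a := 1 - t) (b := t) (by linarith) ht0.le (by ring)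
  rw [hΩ.isOpen.interior_eq] at hmem
  convert hmem using 1
  have h1 : (1 - t : ℂ) ≠ 0 := by exact_mod_cast (by linarith : (1 - t : ℝ) ≠ 0)
  have h2 : (t : ℂ) ≠ 0 := by exact_mod_cast ht0.ne'
  ext i
  fin_cases i
  · simp
    field_simp
  · simp
    field_simp

/-- Near a point of `interior (baseFace Ω) × fibreCone Ω`, shrinking the last coordinate leads
into `Ω`. -/
lemma eventually_mem_of_mem_interior_baseFace {Ω : Set (EuclideanSpace ℂ (Fin 2))}
    (ho : IsOpen Ω) (hc : Convex ℝ Ω) {z w : ℂ} (hz : z ∈ interior (baseFace Ω))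
    (hw : w ∈ fibreCone Ω) :
    ∀ᶠ x : ℝ × (ℂ × ℂ) in 𝓝 (0, (z, w)), 0 < x.1 → !₂[x.2.1, (x.1 : ℂ) * x.2.2] ∈ Ω := by
  obtain ⟨s, hs, p, hp⟩ := hw
  have hsc : (s : ℂ) ≠ 0 := by exact_mod_cast hs.ne'
  have h1 : ∀ᶠ x : ℝ × (ℂ × ℂ) in 𝓝 (0, (z, w)), !₂[p, (s : ℂ) * x.2.2] ∈ Ω := by
    have : Continuous fun x : ℝ × (ℂ × ℂ) =>
        (!₂[p, (s : ℂ) * x.2.2] : EuclideanSpace ℂ (Fin 2)) := by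
      fun_prop
    exact this.continuousAt.eventually_mem (ho.mem_nhds hp)
  have h2 : ∀ᶠ x : ℝ × (ℂ × ℂ) in 𝓝 (0, (z, w)),
      (x.2.1 - (x.1 / s : ℂ) * p) / (1 - (x.1 / s : ℂ)) ∈ interior (baseFace Ω) := by
    have : ContinuousAt (fun x : ℝ × (ℂ × ℂ) =>
        (x.2.1 - (x.1 / s : ℂ) * p) / (1 - (x.1 / s : ℂ))) (0, (z, w)) :=
      ContinuousAt.div (by fun_prop) (by fun_prop) (by simp)
    exact this.eventually_mem (isOpen_interior.mem_nhds (by simpa using hz))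
  have h3 : ∀ᶠ x : ℝ × (ℂ × ℂ) in 𝓝 (0, (z, w)), x.1 < s :=
    continuous_fst.continuousAt.eventually_lt continuousAt_const hs
  filter_upwards [h1, h2, h3] with x hx1 hx2 hx3 hx0
  rw [← ho.interior_eq] at hx1
  have hface : !₂[_, 0] ∈ closure Ω := interior_subset (s := baseFace Ω) hx2
  have hmem := hc.combo_interior_closure_mem_interior hx1 hface
    (a := x.1 / s) (b := 1 - x.1 / s) (by positivity)
    (by rw [sub_nonneg, div_le_one hs]; exact hx3.le) (by ring)
  rw [ho.interior_eq] at hmem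
  convert hmem using 1
  have hne : (1 - (x.1 / s : ℂ)) ≠ 0 := by
    have : (1 - x.1 / s : ℝ) ≠ 0 := by
      have := (div_lt_one hs).2 hx3
      linarith
    exact_mod_cast this
  ext i
  fin_cases i
  · simp
    rw [mul_div_cancel₀ _ hne]
    ring
  · simp
    field_simp

/-- Points of `Ω` over a bounded set with small last coordinate lie close to the face: they
satisfy any strict inequality `c < f` with `f` continuous that holds on the face. -/
lemma eventually_lt_of_forall_mem_baseFace {Ω : Set (EuclideanSpace ℂ (Fin 2))} {f : ℂ → ℝ}
    (hf : Continuous f) {c : ℝ} (h : ∀ z ∈ baseFace Ω, c < f z) {K : Set (ℂ × ℂ)}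
    (hK : IsCompact K) :
    ∀ᶠ τ : ℝ in 𝓝 0, ∀ y ∈ K, !₂[y.1, (τ : ℂ) * y.2] ∈ Ω → c < f y.1 := by
  refine hK.eventually_forall_of_forall_eventually
    (P := fun (τ : ℝ) (y : ℂ × ℂ) => !₂[y.1, (τ : ℂ) * y.2] ∈ Ω → c < f y.1) fun y _ => ?_
  by_cases hy : c < f y.1
  · have : ∀ᶠ x : ℝ × (ℂ × ℂ) in 𝓝 (0, y), c < f x.2.1 :=
      continuousAt_const.eventually_lt (by fun_prop) hy
    filter_upwards [this] with x hx _ using hx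
  · have hcont : Continuous fun x : ℝ × (ℂ × ℂ) =>
        (!₂[x.2.1, (x.1 : ℂ) * x.2.2] : EuclideanSpace ℂ (Fin 2)) := by
      fun_prop
    have hmem : (!₂[y.1, ((0 : ℝ) : ℂ) * y.2] : EuclideanSpace ℂ (Fin 2)) ∈ (closure Ω)ᶜ := by
      intro hcl
      exact hy (h y.1 (by simpa [baseFace] using hcl))
    have : ∀ᶠ x : ℝ × (ℂ × ℂ) in 𝓝 (0, y), !₂[x.2.1, (x.1 : ℂ) * x.2.2] ∈ (closure Ω)ᶜ :=
      hcont.continuousAt.eventually_mem (isClosed_closure.isOpen_compl.mem_nhds hmem)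
    filter_upwards [this] with x hx hxΩ using absurd (subset_closure hxΩ) hx

/-! ### The blow-up -/

/-- The rate `1 / M ^ 2` is such that the discs `|u - 1| ≤ 1 - 1 / M ^ 2`, magnified `M` times at
the origin, exhaust the right half-plane. -/
lemma eventually_norm_div_sub_one_le {ζ : ℂ} (hζ : 0 < ζ.re) :
    ∀ᶠ n : ℕ in atTop, ‖ζ / ((n + 1 : ℝ) : ℂ) - 1‖ ≤ 1 - 1 / (n + 1 : ℝ) ^ 2 := by
  filter_upwards [eventually_ge_atTop ⌈(‖ζ‖ ^ 2 + 2) / ζ.re⌉₊] with n hn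
  have hn' : (‖ζ‖ ^ 2 + 2) / ζ.re ≤ n := (Nat.le_ceil _).trans (by exact_mod_cast hn)
  rw [div_le_iff₀ hζ] at hn'
  set M : ℝ := n + 1 with hM
  have hM1 : 1 ≤ M := by simp [hM]
  have hM0 : (M : ℂ) ≠ 0 := by exact_mod_cast (by positivity : M ≠ 0)
  have hkey : ‖ζ‖ ^ 2 + 2 ≤ 2 * ζ.re * M := by nlinarith
  have hinv : 1 / M ^ 2 ≤ 1 := by
    rw [div_le_one (by positivity)]
    nlinarith
  refine le_of_sq_le_sq ?_ (by linarith)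
  rw [show ζ / M - 1 = (ζ - M) / M by field_simp, norm_div, Complex.norm_real,
    Real.norm_of_nonneg (by linarith), div_pow, div_le_iff₀ (by positivity)]
  have h1 : ‖ζ - M‖ ^ 2 = ‖ζ‖ ^ 2 - 2 * ζ.re * M + M ^ 2 := by
    rw [Complex.sq_norm, Complex.sq_norm, Complex.normSq_apply, Complex.normSq_apply]
    simp
    ring
  have h2 : (1 - 1 / M ^ 2) ^ 2 * M ^ 2 = M ^ 2 - 2 + 1 / M ^ 2 := by
    field_simp
    ring
  have h3 : 0 ≤ 1 / M ^ 2 := by positivity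
  rw [h1, h2]
  linarith

/-- The blow-up in adapted coordinates. The first coordinate is magnified at a boundary point of
the face, the second at a boundary point of the fibre cone, after a much stronger dilation
centred at `0`, which turns `Ω` into almost the product of the face and the fibre cone. -/
theorem isAffineLimit_rightHalfPlane_prod_of_ball_subset_baseFace
    {Ω : Set (EuclideanSpace ℂ (Fin 2))} (hΩ : IsConvexDomainNoLine Ω)
    (hpos : ∀ z ∈ Ω, 0 < (z 1).re) (hface : Metric.ball 0 1 ⊆ baseFace Ω) :
    IsAffineLimit Ω (prodDomain rightHalfPlane rightHalfPlane) := by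
  have hcF := convex_baseFace hΩ.convex
  have hint : (interior (baseFace Ω)).Nonempty :=
    ⟨0, interior_maximal hface Metric.isOpen_ball (by simp)⟩
  obtain ⟨q₁, ρ₁, hρ₁, hin₁, hout₁⟩ := exists_ball_subset_subset_halfPlane isOpen_interior
    hcF.interior hint fun h =>
      baseFace_ne_univ hΩ (Set.eq_univ_of_univ_subset (h ▸ interior_subset))
  have hfib : ∀ w ∈ fibreCone Ω, 0 < w.re := by
    rintro w ⟨s, hs, p, hw⟩
    have := hpos _ hw
    simp only [Matrix.cons_val_one, Matrix.cons_val_fin_one, Complex.re_ofReal_mul] at this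
    exact pos_of_mul_pos_right this hs.le
  obtain ⟨q₂, ρ₂, hρ₂, hin₂, hout₂⟩ := exists_ball_subset_subset_halfPlane
    (isOpen_fibreCone hΩ.isOpen) (convex_fibreCone hΩ.convex) (by
      obtain ⟨x, hx⟩ := hΩ.nonempty
      rw [EuclideanSpace.eq_vec_two x] at hx
      exact ⟨x 1, 1, one_pos, x 0, by simpa using hx⟩)
    (fun h => by
      have := hfib 0 (h ▸ Set.mem_univ _)
      simp at this)
  -- the face itself lies in the closed half-plane
  have hface_re : ∀ z ∈ baseFace Ω, 0 ≤ ((z - q₁) / ρ₁).re := by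
    intro z hz
    have hz' : z ∈ closure (interior (baseFace Ω)) := by
      rw [hcF.closure_interior_eq_closure_of_nonempty_interior hint]
      exact subset_closure hz
    have hcl : IsClosed {z : ℂ | 0 ≤ ((z - q₁) / ρ₁).re} :=
      isClosed_le continuous_const (by fun_prop)
    refine closure_minimal (fun y hy => ?_) hcl hz'
    exact (hout₁ _ (by rwa [mul_div_cancel₀ _ hρ₁, add_sub_cancel])).le
  set C : ℝ := ‖q₁‖ + ‖ρ₁‖ + ‖q₂‖ + ‖ρ₂‖ with hC
  -- the strength `τ` of the dilation of the second coordinate, chosen after the magnification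
  have hchoose : ∀ n : ℕ, ∃ τ : ℝ, 0 < τ ∧ τ < 1 / (n + 1) ∧
      (∀ u v : ℂ, ‖u - 1‖ ≤ 1 - 1 / (n + 1 : ℝ) ^ 2 → ‖v - 1‖ ≤ 1 - 1 / (n + 1 : ℝ) ^ 2 →
        !₂[q₁ + ρ₁ * u, (τ : ℂ) * (q₂ + ρ₂ * v)] ∈ Ω) ∧
      (∀ z w : ℂ, ‖z‖ ≤ C → ‖w‖ ≤ C → !₂[z, (τ : ℂ) * w] ∈ Ω →
        -(1 / (n + 1 : ℝ) ^ 2) < ((z - q₁) / ρ₁).re) := by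
    intro n
    have hn : (0 : ℝ) < 1 / (n + 1 : ℝ) ^ 2 := by positivity
    set K : Set ℂ := Metric.closedBall 1 (1 - 1 / (n + 1 : ℝ) ^ 2) with hK
    have ha : ∀ᶠ τ : ℝ in 𝓝 0, ∀ y ∈ K ×ˢ K,
        0 < τ → !₂[q₁ + ρ₁ * y.1, (τ : ℂ) * (q₂ + ρ₂ * y.2)] ∈ Ω := by
      have hlt : ∀ u ∈ K, ‖u - 1‖ < 1 := fun u hu =>
        (mem_closedBall_iff_norm.1 hu).trans_lt (by linarith)
      refine ((isCompact_closedBall _ _).prod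
        (isCompact_closedBall _ _)).eventually_forall_of_forall_eventually
        (P := fun (τ : ℝ) (y : ℂ × ℂ) =>
          0 < τ → !₂[q₁ + ρ₁ * y.1, (τ : ℂ) * (q₂ + ρ₂ * y.2)] ∈ Ω) fun y hy => ?_
      have hcont : Continuous fun x : ℝ × (ℂ × ℂ) =>
          (x.1, (q₁ + ρ₁ * x.2.1, q₂ + ρ₂ * x.2.2)) := by fun_prop
      exact (hcont.tendsto (0, y)).eventually
        (eventually_mem_of_mem_interior_baseFace hΩ.isOpen hΩ.convex
          (hin₁ _ (hlt _ hy.1)) (hin₂ _ (hlt _ hy.2)))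
    have hb := eventually_lt_of_forall_mem_baseFace
      (f := fun z => ((z - q₁) / ρ₁).re) (by fun_prop) (c := -(1 / (n + 1 : ℝ) ^ 2))
      (fun z hz => by linarith [hface_re z hz])
      ((isCompact_closedBall (0 : ℂ) C).prod (isCompact_closedBall (0 : ℂ) C))
    obtain ⟨ε, hε, h⟩ := Metric.eventually_nhds_iff.1 (ha.and hb)
    obtain ⟨τ, hτ0, hτ⟩ : ∃ τ : ℝ, 0 < τ ∧ τ < min ε (1 / (n + 1)) :=
      exists_between (by positivity)
    obtain ⟨h1, h2⟩ := h (y := τ) (by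
      rw [Real.dist_eq, sub_zero, abs_of_pos hτ0]
      exact hτ.trans_le (min_le_left _ _))
    exact ⟨τ, hτ0, hτ.trans_le (min_le_right _ _),
      fun u v hu hv => h1 (u, v) ⟨mem_closedBall_iff_norm.2 hu, mem_closedBall_iff_norm.2 hv⟩ hτ0,
      fun z w hz hw => h2 (z, w) ⟨mem_closedBall_zero_iff.2 hz, mem_closedBall_zero_iff.2 hw⟩⟩
  choose τ hτ0 hτ1 hτin hτout using hchoose
  have hτc : ∀ n, (τ n : ℂ) ≠ 0 := fun n => by exact_mod_cast (hτ0 n).ne'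
  have hMc : ∀ n : ℕ, ((n + 1 : ℝ) : ℂ) ≠ 0 := fun n => by
    exact_mod_cast (by positivity : (n + 1 : ℝ) ≠ 0)
  set B : ℕ → (EuclideanSpace ℂ (Fin 2) ≃ᵃ[ℂ] EuclideanSpace ℂ (Fin 2)) := fun n =>
    diagAffineEquiv ![q₁, τ n * q₂] ![ρ₁ / ((n + 1 : ℝ) : ℂ), τ n * ρ₂ / ((n + 1 : ℝ) : ℂ)]
      (fun i => by
        fin_cases i
        · exact div_ne_zero hρ₁ (hMc n)
        · exact div_ne_zero (mul_ne_zero (hτc n) hρ₂) (hMc n)) with hB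
  have hBapp : ∀ n z, B n z = !₂[q₁ + ρ₁ * (z 0 / ((n + 1 : ℝ) : ℂ)),
      (τ n : ℂ) * (q₂ + ρ₂ * (z 1 / ((n + 1 : ℝ) : ℂ)))] := by
    intro n z
    ext i
    rw [hB, diagAffineEquiv_apply]
    fin_cases i
    · simp
      ring
    · simp
      ring
  have hmem : ∀ p ∈ prodDomain rightHalfPlane rightHalfPlane,
      ∀ᶠ n in atTop, p ∈ B n ⁻¹' Ω := by
    intro p hp
    filter_upwards [eventually_norm_div_sub_one_le hp.1, eventually_norm_div_sub_one_le hp.2]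
      with n h1 h2
    rw [Set.mem_preimage, hBapp]
    exact hτin n _ _ h1 h2
  have hone : !₂[1, 1] ∈ prodDomain rightHalfPlane rightHalfPlane := by
    simp [prodDomain, rightHalfPlane]
  have hinv : Tendsto (fun n : ℕ => 1 / ((n : ℝ) + 1)) atTop (𝓝 0) :=
    tendsto_one_div_add_atTop_nhds_zero_nat
  refine IsAffineLimit.of_preimage isConvexDomainNoLine_rightHalfPlane_prod B hone
    (q := !₂[q₁, 0]) (fun h => by simpa using hpos _ h) (hmem _ hone) ?_
    (localHausdorffTendsto_rightHalfPlane_prod hmem fun R δ hδ => ?_)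
  · have hτ : Tendsto τ atTop (𝓝 0) :=
      squeeze_zero (fun n => (hτ0 n).le) (fun n => (hτ1 n).le) hinv
    have hcont : Continuous fun x : ℝ × ℝ => (!₂[q₁ + ρ₁ * (x.1 : ℂ),
        (x.2 : ℂ) * (q₂ + ρ₂ * (x.1 : ℂ))] : EuclideanSpace ℂ (Fin 2)) := by fun_prop
    have := (hcont.tendsto (0, 0)).comp (hinv.prodMk_nhds hτ)
    simp only [Complex.ofReal_zero, mul_zero, zero_mul, add_zero] at this
    refine this.congr fun n => ?_
    simp [hBapp]
  · filter_upwards [eventually_ge_atTop ⌈R⌉₊, hinv.eventually (gt_mem_nhds hδ)] with n hn hnδ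
    intro z hz hzR
    have hM : (0 : ℝ) < n + 1 := by positivity
    have hRn : ‖z‖ ≤ n + 1 := by
      have : R ≤ n := (Nat.le_ceil R).trans (by exact_mod_cast hn)
      linarith
    have hcoord (i : Fin 2) : ‖z i / ((n + 1 : ℝ) : ℂ)‖ ≤ 1 := by
      rw [norm_div, Complex.norm_real, Real.norm_of_nonneg hM.le, div_le_one hM]
      exact (PiLp.norm_apply_le z i).trans hRn
    have hbound (q ρ : ℂ) (i : Fin 2) : ‖q + ρ * (z i / ((n + 1 : ℝ) : ℂ))‖ ≤ ‖q‖ + ‖ρ‖ :=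
      (norm_add_le _ _).trans (by
        rw [norm_mul]
        gcongr
        exact mul_le_of_le_one_right (norm_nonneg _) (hcoord i))
    rw [Set.mem_preimage, hBapp] at hz
    constructor
    · have := hτout n _ _ ((hbound q₁ ρ₁ 0).trans (by linarith [norm_nonneg q₂, norm_nonneg ρ₂]))
        ((hbound q₂ ρ₂ 1).trans (by linarith [norm_nonneg q₁, norm_nonneg ρ₁])) hz
      rw [add_sub_cancel_left, mul_div_cancel_left₀ _ hρ₁, Complex.div_ofReal_re,
        lt_div_iff₀ hM] at this
      have h2 : -(1 / (n + 1 : ℝ) ^ 2) * (n + 1) = -(1 / (n + 1)) := by field_simp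
      rw [h2] at this
      linarith
    · have := hout₂ _ ⟨τ n, hτ0 n, _, hz⟩
      rw [Complex.div_ofReal_re] at this
      have : 0 < (z 1).re := (div_pos_iff_of_pos_right hM).1 this
      linarith

/-! ### Normalization of the disc -/

/-- A convex domain whose boundary contains an affine disc looks, in suitable affine coordinates,
like a domain in `{Re z₁ > 0}` whose closure contains the unit disc of the line `{z₁ = 0}`. -/
lemma exists_affineEquiv_ball_subset_baseFace {Ω : Set (EuclideanSpace ℂ (Fin 2))}
    (hΩ : IsConvexDomainNoLine Ω) {A : Set (EuclideanSpace ℂ (Fin 2))}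
    (hA : IsNontrivialAffineDisk A) (hAΩ : A ⊆ frontier Ω) :
    ∃ T : EuclideanSpace ℂ (Fin 2) ≃ᵃ[ℂ] EuclideanSpace ℂ (Fin 2),
      IsConvexDomainNoLine (T ⁻¹' Ω) ∧ (∀ z ∈ T ⁻¹' Ω, 0 < (z 1).re) ∧
        Metric.ball 0 1 ⊆ baseFace (T ⁻¹' Ω) := by
  obtain ⟨l, ⟨s, t, hst⟩, rfl⟩ := hA
  set v := l.linear 1 with hv
  have hl : ∀ z, l z = l 0 + z • v := fun z => by
    have := l.map_vadd 0 z
    rw [vadd_eq_add, add_zero, vadd_eq_add] at this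
    rw [this, hv, ← map_smul, smul_eq_mul, mul_one, add_comm]
  have hv0 : v ≠ 0 := fun h => hst (by rw [hl s, hl t, h]; simp)
  have hfr : ∀ z : ℂ, ‖z‖ < 1 → l z ∈ closure Ω ∧ l z ∉ Ω := fun z hz => by
    have := hAΩ ⟨z, by simpa using hz, rfl⟩
    rwa [hΩ.isOpen.frontier_eq] at this
  -- a supporting functional at `l 0` is complex linear up to taking real parts, and it vanishes
  -- in the direction of the disc
  obtain ⟨f, hf⟩ := RCLike.geometric_hahn_banach_open_point (𝕜 := ℂ) hΩ.convex hΩ.isOpen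
    (hfr 0 (by simp)).2
  simp only [RCLike.re_eq_complex_re] at hf
  have hfcl : ∀ x ∈ closure Ω, (f x).re ≤ (f (l 0)).re :=
    closure_minimal (fun x hx => (hf x hx).le)
      (isClosed_le (Complex.continuous_re.comp f.continuous) continuous_const)
  have hfv : f v = 0 := by
    have hc : (0 : ℝ) < 1 / (1 + ‖f v‖) := by positivity
    have h := hfcl _ (hfr (((1 / (1 + ‖f v‖) : ℝ) : ℂ) * (starRingEnd ℂ) (f v)) (by
      rw [norm_mul, Complex.norm_real, Real.norm_of_nonneg hc.le, RCLike.norm_conj,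
        one_div_mul_eq_div, div_lt_one (by positivity)]
      linarith)).1
    rw [hl, map_add, map_smul, smul_eq_mul, mul_assoc, mul_comm _ (f v), Complex.mul_conj,
      ← Complex.ofReal_mul, Complex.add_re, Complex.ofReal_re] at h
    have h0 : Complex.normSq (f v) ≤ 0 := by
      by_contra! hn
      nlinarith [mul_pos hc hn]
    exact Complex.normSq_eq_zero.1 (le_antisymm h0 (Complex.normSq_nonneg _))
  obtain ⟨w, hfw⟩ : ∃ w, f w = -1 := by
    obtain ⟨x, hx⟩ := hΩ.nonempty
    have hne : f x - f (l 0) ≠ 0 := fun h => by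
      have := hf x hx
      rw [sub_eq_zero.1 h] at this
      exact lt_irrefl _ this
    refine ⟨(-(f x - f (l 0))⁻¹) • (x - l 0), ?_⟩
    rw [map_smul, map_sub, smul_eq_mul, neg_mul, inv_mul_cancel₀ hne]
  let φ : EuclideanSpace ℂ (Fin 2) →ₗ[ℂ] EuclideanSpace ℂ (Fin 2) :=
    { toFun := fun z => z 0 • v + z 1 • w
      map_add' := fun x y => by simp only [PiLp.add_apply]; module
      map_smul' := fun a x => by
        simp only [PiLp.smul_apply, smul_eq_mul, RingHom.id_apply]; module }
  have hφ : Function.Injective φ := by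
    refine (injective_iff_map_eq_zero φ).2 fun z hz => ?_
    have hz' : z 0 • v + z 1 • w = 0 := hz
    have h1 : z 1 = 0 := by
      have := congrArg f hz'
      simpa [hfv, hfw] using this
    have h0 : z 0 = 0 := by simpa [h1, hv0] using hz'
    ext i
    fin_cases i
    · exact h0
    · exact h1
  set T : EuclideanSpace ℂ (Fin 2) ≃ᵃ[ℂ] EuclideanSpace ℂ (Fin 2) :=
    (LinearEquiv.ofInjectiveEndo φ hφ).toAffineEquiv.trans (AffineEquiv.constVAdd ℂ _ (l 0))
    with hT
  have hTapp : ∀ z, T z = l 0 + (z 0 • v + z 1 • w) := fun z => rfl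
  have hTc : Continuous T := T.toAffineMap.continuous_of_finiteDimensional
  have hTc' : Continuous T.symm := T.symm.toAffineMap.continuous_of_finiteDimensional
  have hcl : closure (T ⁻¹' Ω) = T ⁻¹' closure Ω :=
    ((Homeomorph.mk T.toEquiv hTc hTc').preimage_closure Ω).symm
  refine ⟨T, ⟨hΩ.isOpen.preimage hTc, hΩ.nonempty.preimage T.surjective, ?_, ?_⟩, ?_, ?_⟩
  · intro x hx y hy a b ha hb hab
    have := hΩ.convex hx hy ha hb hab
    rw [Set.mem_preimage]
    convert this using 1
    have hp : l 0 = (a + b) • l 0 := by rw [hab, one_smul]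
    simp only [hTapp, PiLp.add_apply, PiLp.smul_apply]
    nth_rewrite 1 [hp]
    simp only [smul_add, add_smul, smul_assoc]
    abel
  · intro p u hu
    have hline : ∀ c : ℂ, T (p + c • u) = T p + c • φ u := fun c => by
      have : φ u = u 0 • v + u 1 • w := rfl
      rw [hTapp, hTapp, this]
      simp only [PiLp.add_apply, PiLp.smul_apply, smul_eq_mul]
      module
    obtain ⟨c, hc⟩ := hΩ.not_line (T p) (φ u) fun h => hu (hφ (h.trans (map_zero φ).symm))
    exact ⟨c, fun h => hc (by rw [← hline]; exact h)⟩
  · intro z hz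
    have := hf _ hz
    rw [hTapp, map_add, map_add, map_smul, map_smul, hfv, hfw] at this
    simp at this
    exact this
  · intro a ha
    have := (hfr a (by simpa using ha)).1
    rw [hl] at this
    simpa [baseFace, hcl, hTapp] using this

theorem mainTheorem7 (Ω : Set (EuclideanSpace ℂ (Fin 2)))
    (hΩ : IsConvexDomainNoLine Ω)
    (hdisk : ∃ A : Set (EuclideanSpace ℂ (Fin 2)), IsNontrivialAffineDisk A ∧ A ⊆ frontier Ω) :
    ∃ D₁ D₂ : Set ℂ,
      (IsOpen D₁ ∧ D₁.Nonempty ∧ Convex ℝ D₁) ∧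
      (IsOpen D₂ ∧ D₂.Nonempty ∧ Convex ℝ D₂) ∧
      IsAffineLimit Ω (prodDomain D₁ D₂) ∧
      Biholomorphic (prodDomain D₁ D₂)
        (prodDomain (Metric.ball (0 : ℂ) 1) (Metric.ball (0 : ℂ) 1)) := by
  obtain ⟨A, hA, hAΩ⟩ := hdisk
  obtain ⟨T, hT, hpos, hface⟩ := exists_affineEquiv_ball_subset_baseFace hΩ hA hAΩ
  exact ⟨rightHalfPlane, rightHalfPlane,
    ⟨isOpen_rightHalfPlane, nonempty_rightHalfPlane, convex_rightHalfPlane⟩,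
    ⟨isOpen_rightHalfPlane, nonempty_rightHalfPlane, convex_rightHalfPlane⟩,
    (isAffineLimit_rightHalfPlane_prod_of_ball_subset_baseFace hT hpos hface)
      |>.of_preimage_affineEquiv T,
    biholomorphic_rightHalfPlane_prod⟩
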